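/- Let $d\ge 1$ and let $k:\mathbb R^d\to\mathbb R$ be a stationary, isotropic covariance function, i.e. $(x,y)\mapsto k(x-y)$ is symmetric and positive semidefinite on $\mathbb R^d$ and $k(x)$ depends only on $\|x\|_2$. Assume that $k\in L^2(\mathbb R^d)$ (this holds in particular if $k$ is integrable). Let $S$ be the spectral density of $k$, that is, $S$ is the Fourier transform of $k$ with the convention $S(\xi)=\int_{\mathbb R^d}k(x)e^{-2\pi i\langle x,\xi\rangle}\,dx$ (understood in the sense of tempered distributions if $k$ is not integrable). Then the self-convolution $(k*k)(x)=\int_{\mathbb R^d}k(y)k(x-y)\,dy$ converges absolutely for every $x\in\mathbb R^d$; the spectral density is (almost everywhere) a function of $s=\|\xi\|_2$ only, again written $S(s)$; and for every $x\neq 0$, with $r=\|x\|_2$, $$(k*k)(x)=\frac{2\pi}{r^{\frac d2-1}}\int_0^\infty S(s)^2\,J_{\frac d2-1}(2\pi r s)\,s^{\frac d2}\,ds,$$ where the integral converges absolutely and $J_{\frac d2-1}$ is the Bessel function of the first kind of order $\frac d2-1$. As $r\to 0^+$ the right-hand side tends to $(k*k)(0)$. -/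

import Mathlib

open scoped Convolution SchwartzMap FourierTransform Topology

/-- The Bessel function of the first kind of real order `ν`,
`J_ν(x) = ∑_{m ≥ 0} (-1)^m / (m! Γ(m + ν + 1)) (x / 2)^(2 m + ν)`, for `x > 0`.
(`1 / Γ` vanishes at the poles of `Γ`, which agrees with `Real.Gamma` being `0` there.) -/
noncomputable def besselJ (ν x : ℝ) : ℝ :=
  ∑' m : ℕ, (-1 : ℝ) ^ m / ((m.factorial : ℝ) * Real.Gamma (m + ν + 1)) * (x / 2) ^ (2 * m + ν)

/-- `K` is a covariance function on `X`: every Gram matrix `(K (x i) (x j))` is symmetric and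
positive semidefinite. -/
def IsCovarianceFunction {X : Type*} (K : X → X → ℝ) : Prop :=
  ∀ (n : ℕ) (x : Fin n → X), (Matrix.of fun i j => K (x i) (x j)).PosSemidef

/-- `k` is a stationary, isotropic covariance function on `ℝ^d`: `(x, y) ↦ k (x - y)` is a
covariance function, and `k x` depends only on the Euclidean norm of `x`. -/
structure IsStationaryIsotropicCovariance {d : ℕ} (k : EuclideanSpace ℝ (Fin d) → ℝ) : Prop where
  covariance : IsCovarianceFunction fun x y => k (x - y)
  isotropic : ∀ x y, ‖x‖ = ‖y‖ → k x = k y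

/-- The function `S` is the spectral density of the stationary covariance function `k`, that is,
`S` is the Fourier transform of `k` (with kernel `exp (-2 π i ⟪x, ξ⟫)`), in the sense of tempered
distributions: `∫ k (𝓕 φ) = ∫ S φ` for all Schwartz functions `φ`. This includes the case where
`k` is integrable and `S ξ = ∫ k x exp (-2 π i ⟪x, ξ⟫) dx`, and the case where `S` is integrable
and `k x = ∫ S ξ exp (2 π i ⟪x, ξ⟫) dξ`. -/
structure IsSpectralDensity {d : ℕ} (k S : EuclideanSpace ℝ (Fin d) → ℝ) : Prop where
  locallyIntegrable : MeasureTheory.LocallyIntegrable S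
  integrable_mul : ∀ φ : 𝓢(EuclideanSpace ℝ (Fin d), ℂ),
    MeasureTheory.Integrable fun ξ => (S ξ : ℂ) * φ ξ
  integral_fourier : ∀ φ : 𝓢(EuclideanSpace ℝ (Fin d), ℂ),
    ∫ x, (k x : ℂ) * (𝓕 φ) x = ∫ ξ, (S ξ : ℂ) * φ ξ

open MeasureTheory

/-! By isotropy `k` is even, so `k * k` is the autocorrelation `∫ k y * k (y - x)`. Plancherel,
applied to `k` and its translate by `x`, turns this into `∫ S ^ 2 * cos (2π⟪x, ξ⟫)`
(`integral_mul_sub_eq_integral_sq_mul_cos`). Since `k` is rotation invariant, so is `S` up to null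
sets, and averaging over the orthogonal group makes it a function of the norm
(`exists_ae_eq_comp_norm`). In polar coordinates the angular integral of the cosine is a Bessel
function (`integral_sphere_cos_inner`), found by integrating the cosine series termwise with sphere
moments read off from Gaussian integrals.

Absolute convergence needs no Bessel asymptotics: the angular integral is bounded and `S ^ 2` is
integrable. The limit at the origin is dominated convergence in the cosine integral. -/

/-! ### Polar coordinates, sphere moments and the Bessel function -/

/-- Integration in polar coordinates. -/
lemma integral_eq_integral_Ioi_integral_sphere {E : Type*} [NormedAddCommGroup E]
    [NormedSpace ℝ E] [FiniteDimensional ℝ E] [Nontrivial E] [MeasurableSpace E] [BorelSpace E]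
    (μ : Measure E) [μ.IsAddHaarMeasure] {F : E → ℝ} (hF : Integrable F μ) :
    ∫ ξ, F ξ ∂μ = ∫ s in Set.Ioi (0 : ℝ), s ^ (Module.finrank ℝ E - 1) *
      ∫ ω : Metric.sphere (0 : E) 1, F (s • (ω : E)) ∂μ.toSphere := by
  have hmp := μ.measurePreserving_homeomorphUnitSphereProd
  have hemb := (homeomorphUnitSphereProd E).measurableEmbedding
  let G : Metric.sphere (0 : E) 1 × Set.Ioi (0 : ℝ) → ℝ := fun p => F ((p.2 : ℝ) • (p.1 : E))
  have hG : ∀ ξ : ({0}ᶜ : Set E), G (homeomorphUnitSphereProd E ξ) = F ξ := by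
    intro ξ
    have h := congrArg Subtype.val ((homeomorphUnitSphereProd E).symm_apply_apply ξ)
    simp only [homeomorphUnitSphereProd_symm_apply_coe] at h
    simp only [G, h]
  have hGi : Integrable G (μ.toSphere.prod (.volumeIoiPow (Module.finrank ℝ E - 1))) := by
    rw [← hmp.integrable_comp_emb hemb]
    have : G ∘ homeomorphUnitSphereProd E = F ∘ Subtype.val := funext hG
    rw [this, ← integrableOn_iff_comap_subtypeVal (measurableSet_singleton _).compl]
    exact hF.integrableOn
  calc
    ∫ ξ, F ξ ∂μ = ∫ ξ : ({(0)}ᶜ : Set E), F ξ ∂(μ.comap (↑)) := by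
      rw [integral_subtype_comap (measurableSet_singleton _).compl F,
        restrict_compl_singleton]
    _ = ∫ p, G p ∂μ.toSphere.prod (.volumeIoiPow (Module.finrank ℝ E - 1)) := by
      rw [← hmp.integral_comp hemb]
      simp only [hG]
    _ = ∫ s : Set.Ioi (0 : ℝ), ∫ ω, G (ω, s) ∂μ.toSphere
          ∂.volumeIoiPow (Module.finrank ℝ E - 1) := integral_prod_symm G hGi
    _ = _ := by
      simp only [Measure.volumeIoiPow, ENNReal.ofReal]
      rw [integral_withDensity_eq_integral_smul,
        integral_subtype_comap measurableSet_Ioi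
          fun a ↦ Real.toNNReal (a ^ (Module.finrank ℝ E - 1)) •
            ∫ ω : Metric.sphere (0 : E) 1, F (a • (ω : E)) ∂μ.toSphere,
        setIntegral_congr_fun measurableSet_Ioi fun x hx ↦ ?_]
      · rw [NNReal.smul_def, Real.coe_toNNReal _ (pow_nonneg hx.out.le _), smul_eq_mul]
      · exact (measurable_subtype_coe.pow_const _).real_toNNReal

lemma exists_linearIsometryEquiv_apply_eq {E : Type*} [NormedAddCommGroup E]
    [InnerProductSpace ℝ E] [FiniteDimensional ℝ E] {x y : E} (h : ‖x‖ = ‖y‖) :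
    ∃ A : E ≃ₗᵢ[ℝ] E, A x = y :=
  ⟨_, Submodule.reflection_sub h⟩

lemma integrable_pow_mul_exp_neg_sq (n : ℕ) :
    Integrable fun t : ℝ => t ^ n * Real.exp (-t ^ 2) := by
  have := integrable_rpow_mul_exp_neg_mul_sq (b := 1) one_pos (s := n)
    (by linarith [n.cast_nonneg (α := ℝ)])
  simpa using this

lemma integral_Ioi_pow_mul_exp_neg_sq (n : ℕ) :
    ∫ t in Set.Ioi (0 : ℝ), t ^ n * Real.exp (-t ^ 2) = Real.Gamma ((n + 1) / 2) / 2 := by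
  have := integral_rpow_mul_exp_neg_rpow (p := 2) (q := n) two_pos
    (by linarith [n.cast_nonneg (α := ℝ)])
  simp only [Real.rpow_natCast, Real.rpow_ofNat] at this
  rw [this]
  ring

lemma integral_pow_mul_exp_neg_sq (m : ℕ) :
    ∫ t : ℝ, t ^ (2 * m) * Real.exp (-t ^ 2) = Real.Gamma (m + 1 / 2) := by
  have := integral_comp_abs (f := fun t : ℝ => t ^ (2 * m) * Real.exp (-t ^ 2))
  simp only [pow_mul, sq_abs] at this
  simp only [pow_mul]
  rw [this]
  simp only [← pow_mul]
  rw [integral_Ioi_pow_mul_exp_neg_sq]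
  push_cast
  rw [show ((2 * (m : ℝ) + 1) / 2) = m + 1 / 2 by ring]
  ring

lemma integrable_inner_pow_mul_exp_neg_norm_sq {n : ℕ} (x : EuclideanSpace ℝ (Fin (n + 1)))
    (m : ℕ) :
    Integrable (fun ξ => inner ℝ x ξ ^ (2 * m) * Real.exp (-‖ξ‖ ^ 2)) ∧
    ∫ ξ, inner ℝ x ξ ^ (2 * m) * Real.exp (-‖ξ‖ ^ 2) =
      ‖x‖ ^ (2 * m) * (Real.Gamma (m + 1 / 2) * √Real.pi ^ n) := by
  -- Rotating `x` onto the first axis makes the integrand a product of one-variable functions.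
  obtain ⟨A, hA⟩ := exists_linearIsometryEquiv_apply_eq (x := x)
    (y := ‖x‖ • EuclideanSpace.single (0 : Fin (n + 1)) (1 : ℝ)) (by simp [norm_smul])
  let f : Fin (n + 1) → ℝ → ℝ :=
    Fin.cons (fun t => t ^ (2 * m) * Real.exp (-t ^ 2)) fun _ t => Real.exp (-t ^ 2)
  have hf : ∀ η : EuclideanSpace ℝ (Fin (n + 1)),
      (‖x‖ * η 0) ^ (2 * m) * Real.exp (-‖η‖ ^ 2) = ‖x‖ ^ (2 * m) * ∏ i, f i (η i) := by
    intro η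
    simp only [f, Fin.prod_univ_succ, Fin.cons_zero, Fin.cons_succ, EuclideanSpace.real_norm_sq_eq,
      neg_add, Real.exp_add, Fin.sum_univ_succ, ← Finset.sum_neg_distrib, Real.exp_sum]
    ring
  have hcomp : (fun ξ => inner ℝ x ξ ^ (2 * m) * Real.exp (-‖ξ‖ ^ 2)) =
      (fun η : Fin (n + 1) → ℝ => ‖x‖ ^ (2 * m) * ∏ i, f i (η i)) ∘
        (MeasurableEquiv.toLp 2 (Fin (n + 1) → ℝ)).symm ∘ A := by
    ext ξ
    have h1 := hf (A ξ)
    rw [LinearIsometryEquiv.norm_map] at h1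
    rw [← A.inner_map_map, hA, inner_smul_left]
    simpa [EuclideanSpace.inner_single_left] using h1
  have hint : Integrable fun η : Fin (n + 1) → ℝ => ‖x‖ ^ (2 * m) * ∏ i, f i (η i) := by
    refine Integrable.const_mul (Integrable.fintype_prod fun i => ?_) _
    refine Fin.cases ?_ (fun j => ?_) i
    · exact integrable_pow_mul_exp_neg_sq _
    · simpa [f] using integrable_pow_mul_exp_neg_sq 0
  have hmp : MeasurePreserving (MeasurableEquiv.toLp 2 (Fin (n + 1) → ℝ)).symm :=
    EuclideanSpace.volume_preserving_symm_measurableEquiv_toLp _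
  have hmp' := hmp.comp A.measurePreserving
  have hemb := (MeasurableEquiv.toLp 2 (Fin (n + 1) → ℝ)).symm.measurableEmbedding.comp
    A.toHomeomorph.measurableEmbedding
  rw [hcomp]
  constructor
  · exact (hmp'.integrable_comp_emb hemb).2 hint
  · have := hmp'.integral_comp hemb
      (fun η : Fin (n + 1) → ℝ => ‖x‖ ^ (2 * m) * ∏ i, f i (η i))
    refine this.trans ?_
    rw [integral_const_mul, integral_fintype_prod_volume_eq_prod, Fin.prod_univ_succ]
    have hg : ∫ t : ℝ, Real.exp (-t ^ 2) = √Real.pi := by simpa using integral_gaussian 1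
    simp only [f, Fin.cons_zero, Fin.cons_succ, integral_pow_mul_exp_neg_sq, hg,
      Finset.prod_const, Finset.card_univ, Fintype.card_fin]

/-- The even moments of a linear functional on the unit sphere. -/
lemma integral_sphere_inner_pow {d : ℕ} (hd : 1 ≤ d) (x : EuclideanSpace ℝ (Fin d)) (m : ℕ) :
    ∫ ω : Metric.sphere (0 : EuclideanSpace ℝ (Fin d)) 1, inner ℝ x (ω : _) ^ (2 * m)
      ∂(volume : Measure (EuclideanSpace ℝ (Fin d))).toSphere =
    2 * √Real.pi ^ (d - 1) * Real.Gamma (m + 1 / 2) / Real.Gamma (m + d / 2) * ‖x‖ ^ (2 * m) := by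
  obtain ⟨n, rfl⟩ : ∃ n, d = n + 1 := ⟨d - 1, by omega⟩
  obtain ⟨hi, hv⟩ := integrable_inner_pow_mul_exp_neg_norm_sq x m
  -- By homogeneity the Gaussian moment is a radial Gamma integral times the sphere moment, so the
  -- latter is a quotient.
  rw [integral_eq_integral_Ioi_integral_sphere volume hi] at hv
  have hG : Real.Gamma (m + (n + 1 : ℕ) / 2) ≠ 0 := (Real.Gamma_pos_of_pos (by positivity)).ne'
  have hs : ∀ s ∈ Set.Ioi (0 : ℝ), s ^ (Module.finrank ℝ (EuclideanSpace ℝ (Fin (n + 1))) - 1) *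
      ∫ ω : Metric.sphere (0 : EuclideanSpace ℝ (Fin (n + 1))) 1,
        inner ℝ x (s • (ω : EuclideanSpace ℝ (Fin (n + 1)))) ^ (2 * m) *
          Real.exp (-‖s • (ω : EuclideanSpace ℝ (Fin (n + 1)))‖ ^ 2)
        ∂(volume : Measure (EuclideanSpace ℝ (Fin (n + 1)))).toSphere =
      (s ^ (2 * m + n) * Real.exp (-s ^ 2)) *
        ∫ ω : Metric.sphere (0 : EuclideanSpace ℝ (Fin (n + 1))) 1, inner ℝ x (ω : _) ^ (2 * m)
          ∂(volume : Measure (EuclideanSpace ℝ (Fin (n + 1)))).toSphere := by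
    intro s hs
    rw [← integral_const_mul, ← integral_const_mul]
    congr 1
    ext ω
    have : ‖(ω : EuclideanSpace ℝ (Fin (n + 1)))‖ = 1 := by simp
    simp only [norm_smul, this, inner_smul_right, mul_one, Real.norm_eq_abs, sq_abs,
      finrank_euclideanSpace, Fintype.card_fin, Nat.add_sub_cancel]
    ring
  rw [setIntegral_congr_fun measurableSet_Ioi hs, integral_mul_const,
    integral_Ioi_pow_mul_exp_neg_sq] at hv
  have e : (((2 * m + n : ℕ) : ℝ) + 1) / 2 = m + (n + 1 : ℕ) / 2 := by push_cast; ring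
  rw [e] at hv
  rw [Nat.add_sub_cancel]
  generalize Real.Gamma (m + (n + 1 : ℕ) / 2) = a at *
  generalize Real.Gamma (m + 1 / 2) = b at *
  field_simp
  linear_combination 2 * hv

/-- A form of the duplication formula: it trades the `(2m)!` of the cosine series for the `4 ^ m *
m!` of the Bessel series. -/
lemma gamma_nat_add_half_div_factorial (m : ℕ) :
    Real.Gamma (m + 1 / 2) / (2 * m).factorial = √Real.pi / (4 ^ m * m.factorial) := by
  have h : ((2 * m).factorial : ℝ) = (2 * m - 1 : ℕ).doubleFactorial * (2 ^ m * m.factorial) := by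
    rcases m with - | m
    · simp
    · rw [show 2 * (m + 1) = (2 * m + 1) + 1 by ring, Nat.factorial_eq_mul_doubleFactorial,
        show 2 * m + 1 + 1 = 2 * (m + 1) by ring, Nat.doubleFactorial_two_mul,
        show 2 * (m + 1) - 1 = 2 * m + 1 by omega]
      push_cast
      ring
  have h0 : ((2 * m - 1 : ℕ).doubleFactorial : ℝ) ≠ 0 := by
    exact_mod_cast (Nat.doubleFactorial_pos _).ne'
  rw [Real.Gamma_nat_add_half, h, show (4 : ℝ) = 2 * 2 by norm_num, mul_pow]
  field_simp

/-- The Fourier transform of the surface measure of the unit sphere as a Bessel function. -/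
lemma integral_sphere_cos_inner {d : ℕ} (hd : 1 ≤ d) {x : EuclideanSpace ℝ (Fin d)}
    (hx : x ≠ 0) :
    ∫ ω : Metric.sphere (0 : EuclideanSpace ℝ (Fin d)) 1, Real.cos (inner ℝ x (ω : _))
      ∂(volume : Measure (EuclideanSpace ℝ (Fin d))).toSphere =
    2 * Real.pi ^ ((d : ℝ) / 2) * (‖x‖ / 2) ^ (1 - (d : ℝ) / 2) *
      besselJ ((d : ℝ) / 2 - 1) ‖x‖ := by
  have hx0 : 0 < ‖x‖ := norm_pos_iff.2 hx
  set μ := (volume : Measure (EuclideanSpace ℝ (Fin d))).toSphere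
  let F : ℕ → Metric.sphere (0 : EuclideanSpace ℝ (Fin d)) 1 → ℝ := fun m ω =>
    (-1) ^ m * inner ℝ x (ω : _) ^ (2 * m) / (2 * m).factorial
  have hbound : ∀ m ω, ‖F m ω‖ ≤ ‖x‖ ^ (2 * m) / (2 * m).factorial := by
    intro m ω
    have h1 : |inner ℝ x (ω : EuclideanSpace ℝ (Fin d))| ≤ ‖x‖ := by
      simpa using abs_real_inner_le_norm x (ω : EuclideanSpace ℝ (Fin d))
    simp only [F, norm_div, norm_mul, norm_pow, norm_neg, norm_one, one_pow, one_mul,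
      Real.norm_eq_abs, Nat.abs_cast]
    gcongr
  have hFi : ∀ m, Integrable (F m) μ := by
    intro m
    refine Integrable.of_bound (Continuous.aestronglyMeasurable (by fun_prop)) _
      (Filter.Eventually.of_forall (hbound m))
  -- The `cosh` series dominates uniformly on the sphere and justifies termwise integration.
  have hcosh : Summable fun m => ‖x‖ ^ (2 * m) / ((2 * m).factorial : ℝ) :=
    (Real.hasSum_cosh ‖x‖).summable
  have hsum : Summable fun m => ∫ ω, ‖F m ω‖ ∂μ := by
    refine (hcosh.mul_left (μ.real Set.univ)).of_nonneg_of_le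
      (fun m => integral_nonneg fun ω => norm_nonneg _) fun m => ?_
    calc ∫ ω, ‖F m ω‖ ∂μ ≤ ∫ _, ‖x‖ ^ (2 * m) / (2 * m).factorial ∂μ :=
          integral_mono (hFi m).norm (integrable_const _) (hbound m)
      _ = _ := by rw [integral_const, smul_eq_mul]
  have hcos : ∀ ω : Metric.sphere (0 : EuclideanSpace ℝ (Fin d)) 1,
      Real.cos (inner ℝ x (ω : _)) = ∑' m, F m ω := fun ω => (Real.hasSum_cos _).tsum_eq.symm
  simp only [hcos]
  rw [integral_tsum_of_summable_integral_norm hFi hsum |>.symm, besselJ, ← tsum_mul_left]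
  congr 1
  ext m
  have h1 : ∫ ω, F m ω ∂μ = (-1) ^ m / (2 * m).factorial *
      ∫ ω : Metric.sphere (0 : EuclideanSpace ℝ (Fin d)) 1, inner ℝ x (ω : _) ^ (2 * m) ∂μ := by
    rw [← integral_const_mul]
    congr 1
    ext ω
    simp only [F]
    ring
  have h2 := gamma_nat_add_half_div_factorial m
  have h3 : (‖x‖ / 2) ^ (1 - (d : ℝ) / 2) * (‖x‖ / 2) ^ (2 * (m : ℝ) + ((d : ℝ) / 2 - 1)) =
      ‖x‖ ^ (2 * m) / 4 ^ m := by
    rw [← Real.rpow_add (by positivity),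
      show 1 - (d : ℝ) / 2 + (2 * (m : ℝ) + ((d : ℝ) / 2 - 1)) = (2 * m : ℕ) by push_cast; ring,
      Real.rpow_natCast, div_pow, pow_mul 2 2 m]
    norm_num
  have h4 : Real.pi ^ ((d : ℝ) / 2) = √Real.pi ^ (d - 1) * √Real.pi := by
    rw [← pow_succ, Nat.sub_add_cancel hd, Real.sqrt_eq_rpow, ← Real.rpow_natCast,
      ← Real.rpow_mul Real.pi_pos.le]
    ring_nf
  rw [h1, integral_sphere_inner_pow hd, h4]
  have h5 : (m : ℝ) + ((d : ℝ) / 2 - 1) + 1 = m + d / 2 := by ring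
  rw [h5]
  calc _ = (-1) ^ m * 2 * √Real.pi ^ (d - 1) / Real.Gamma (m + d / 2) * ‖x‖ ^ (2 * m) *
        (Real.Gamma (m + 1 / 2) / (2 * m).factorial) := by ring
    _ = (-1) ^ m * 2 * √Real.pi ^ (d - 1) / Real.Gamma (m + d / 2) * √Real.pi / m.factorial *
        (‖x‖ ^ (2 * m) / 4 ^ m) := by rw [h2]; field_simp
    _ = _ := by rw [← h3]; field_simp

/-! ### Plancherel for the distributional spectral density -/

section Fourier

variable {E : Type*} [NormedAddCommGroup E] [InnerProductSpace ℝ E] [FiniteDimensional ℝ E]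
  [MeasurableSpace E] [BorelSpace E]

/-- The distributional Fourier transform of a square-integrable function, if it is a locally
integrable function, agrees with the `L²` Fourier transform. -/
lemma ae_eq_fourier_toLp {f S : E → ℂ} (hf : MemLp f 2) (hS : LocallyIntegrable S)
    (h : ∀ g : 𝓢(E, ℂ), HasCompactSupport g → ∫ x, f x * (𝓕 g) x = ∫ ξ, S ξ * g ξ) :
    S =ᵐ[volume] (𝓕 (hf.toLp f) : Lp ℂ 2 (volume : Measure E)) := by
  refine ae_eq_of_integral_contDiff_smul_eq hS
    ((Lp.memLp _).locallyIntegrable (by norm_num)) fun g g_smooth g_cpt => ?_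
  have hg₁ : HasCompactSupport (Complex.ofRealCLM ∘ g) := g_cpt.comp_left rfl
  have hg₂ : ContDiff ℝ (⊤ : ℕ∞) (Complex.ofRealCLM ∘ g) := by fun_prop
  have h1 := h (hg₁.toSchwartzMap hg₂) hg₁
  have h2 := DFunLike.congr_fun (Lp.fourier_toTemperedDistribution_eq (hf.toLp f))
    (hg₁.toSchwartzMap hg₂)
  rw [TemperedDistribution.fourier_apply, Lp.toTemperedDistribution_apply,
    Lp.toTemperedDistribution_apply] at h2
  calc ∫ x, g x • S x = ∫ ξ, S ξ * (hg₁.toSchwartzMap hg₂) ξ := by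
        congr 1; ext ξ; simp [mul_comm]
    _ = ∫ x, (𝓕 (hg₁.toSchwartzMap hg₂)) x • (hf.toLp f) x := by
        rw [← h1]
        refine integral_congr_ae ?_
        filter_upwards [hf.coeFn_toLp] with x hx
        rw [hx, smul_eq_mul, mul_comm]
    _ = _ := by
        rw [h2]; simp

/-- Multiplication of a compactly supported Schwartz function by a character. -/
lemma exists_schwartzMap_char_mul (g : 𝓢(E, ℂ)) (hg : HasCompactSupport g) (x : E) :
    ∃ g' : 𝓢(E, ℂ),
      (∀ ξ, g' ξ = Complex.exp (-(2 * Real.pi * inner ℝ x ξ : ℝ) * Complex.I) * g ξ) ∧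
      ∀ y, (𝓕 g') y = (𝓕 g) (y + x) := by
  have h1 : HasCompactSupport fun ξ =>
      Complex.exp (-(2 * Real.pi * inner ℝ x ξ : ℝ) * Complex.I) * g ξ := hg.mul_left
  have h2 : ContDiff ℝ (⊤ : ℕ∞) fun ξ =>
      Complex.exp (-(2 * Real.pi * inner ℝ x ξ : ℝ) * Complex.I) * g ξ := by
    have := g.smooth ⊤
    have h3 : ContDiff ℝ (⊤ : ℕ∞) fun ξ : E => ((2 * Real.pi * inner ℝ x ξ : ℝ) : ℂ) :=
      Complex.ofRealCLM.contDiff.comp (contDiff_const.mul (contDiff_const.inner ℝ contDiff_id))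
    exact ((h3.neg.mul contDiff_const).cexp).mul this
  refine ⟨h1.toSchwartzMap h2, fun ξ => rfl, fun y => ?_⟩
  rw [SchwartzMap.fourier_coe, SchwartzMap.fourier_coe, Real.fourier_eq', Real.fourier_eq']
  congr 1
  ext ξ
  simp only [HasCompactSupport.toSchwartzMap_toFun, smul_eq_mul]
  rw [← mul_assoc, ← Complex.exp_add, inner_add_right, real_inner_comm ξ x]
  congr 2
  push_cast
  ring

/-- Plancherel's identity for the autocorrelation of a square-integrable function. -/
lemma integral_mul_sub_eq_integral_sq_mul_cos {k S : E → ℝ} (hk : MemLp k 2)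
    (hS : LocallyIntegrable S)
    (h : ∀ g : 𝓢(E, ℂ), ∫ x, (k x : ℂ) * (𝓕 g) x = ∫ ξ, (S ξ : ℂ) * g ξ) :
    MemLp S 2 ∧ ∀ x, ∫ y, k y * k (y - x) = ∫ ξ, S ξ ^ 2 * Real.cos (2 * Real.pi * inner ℝ x ξ) := by
  have hSC : LocallyIntegrable fun ξ => (S ξ : ℂ) := fun x =>
    let ⟨s, hs, hi⟩ := hS x
    ⟨s, hs, hi.ofReal⟩
  have hkC : MemLp (fun y => (k y : ℂ)) 2 := hk.ofReal
  have e0 := ae_eq_fourier_toLp hkC hSC fun g _ => h g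
  have hSm : MemLp (fun ξ => (S ξ : ℂ)) 2 := (memLp_congr_ae e0).2 (Lp.memLp _)
  refine ⟨by simpa using hSm.re, fun x => ?_⟩
  have hkx : MemLp (fun y => (k (y - x) : ℂ)) 2 :=
    hkC.comp_measurePreserving (measurePreserving_sub_right volume x)
  have hc : Continuous fun ξ : E =>
      Complex.exp (-(2 * Real.pi * inner ℝ x ξ : ℝ) * Complex.I) := by fun_prop
  have hSx : LocallyIntegrable fun ξ =>
      Complex.exp (-(2 * Real.pi * inner ℝ x ξ : ℝ) * Complex.I) * (S ξ : ℂ) := by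
    rw [← locallyIntegrableOn_univ] at hSC ⊢
    exact hSC.continuousOn_mul hc.continuousOn isOpen_univ.isLocallyClosed
  -- Translating `k` by `x` multiplies its transform by a character; in the weak formulation the
  -- character moves onto the test function.
  have ex := ae_eq_fourier_toLp hkx hSx fun g hg => by
    obtain ⟨g', hg', hF⟩ := exists_schwartzMap_char_mul g hg x
    rw [← integral_add_right_eq_self _ x]
    simp only [add_sub_cancel_right, ← hF]
    rw [h g']
    congr 1
    ext ξ
    rw [hg']
    ring
  have hP := Lp.inner_fourier_eq (hkC.toLp _) (hkx.toLp _)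
  rw [L2.inner_def, L2.inner_def] at hP
  have hl : ∫ ξ, inner ℂ ((𝓕 (hkC.toLp _) : Lp ℂ 2 (volume : Measure E)) ξ)
      ((𝓕 (hkx.toLp _) : Lp ℂ 2 (volume : Measure E)) ξ) =
      ∫ ξ, Complex.exp (-(2 * Real.pi * inner ℝ x ξ : ℝ) * Complex.I) * (S ξ : ℂ) ^ 2 := by
    refine integral_congr_ae ?_
    filter_upwards [e0, ex] with ξ h1 h2
    rw [← h1, ← h2]
    simp
    ring
  have hr : ∫ y, inner ℂ (hkC.toLp _ y) (hkx.toLp _ y) = ((∫ y, k y * k (y - x) : ℝ) : ℂ) := by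
    rw [← integral_complex_ofReal]
    refine integral_congr_ae ?_
    filter_upwards [hkC.coeFn_toLp, hkx.coeFn_toLp] with ξ h1 h2
    rw [h1, h2]
    simp [mul_comm]
  rw [hl, hr] at hP
  have hi : Integrable fun ξ =>
      Complex.exp (-(2 * Real.pi * inner ℝ x ξ : ℝ) * Complex.I) * (S ξ : ℂ) ^ 2 := by
    have : Integrable fun ξ => (S ξ : ℂ) ^ 2 := by
      simp only [sq]
      exact hSm.integrable_mul hSm
    refine this.bdd_mul (c := 1) hc.aestronglyMeasurable (Filter.Eventually.of_forall fun ξ => ?_)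
    rw [← Complex.ofReal_neg, Complex.norm_exp_ofReal_mul_I]
  -- The autocorrelation is real, so only the cosine part of the character survives.
  have := congrArg RCLike.re hP
  rw [← integral_re hi] at this
  simp only [RCLike.re_eq_complex_re, Complex.ofReal_re] at this
  rw [← this]
  congr 1
  ext ξ
  rw [← Complex.ofReal_pow, Complex.re_mul_ofReal, ← Complex.ofReal_neg, Complex.exp_ofReal_mul_I_re,
    Real.cos_neg, mul_comm]

end Fourier

/-! ### Radial symmetry of the spectral density -/

section Radial

variable {E : Type*} [NormedAddCommGroup E] [InnerProductSpace ℝ E] [FiniteDimensional ℝ E]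
  [MeasurableSpace E] [BorelSpace E]

/-- The distributional Fourier transform of a radial function is invariant under isometries. -/
lemma fourier_comp_linearIsometryEquiv_ae_eq {k S : E → ℝ} (hk : ∀ x y, ‖x‖ = ‖y‖ → k x = k y)
    (hS : LocallyIntegrable S)
    (h : ∀ g : 𝓢(E, ℂ), ∫ x, (k x : ℂ) * (𝓕 g) x = ∫ ξ, (S ξ : ℂ) * g ξ) (A : E ≃ₗᵢ[ℝ] E) :
    ∀ᵐ ξ, S (A ξ) = S ξ := by
  have hSA : LocallyIntegrable fun ξ => S (A ξ) := by
    rw [locallyIntegrable_iff] at hS ⊢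
    intro K hK
    have := hS (A '' K) (hK.image A.continuous)
    rw [A.measurePreserving.integrableOn_image A.toHomeomorph.measurableEmbedding] at this
    exact this
  refine ae_eq_of_integral_contDiff_smul_eq hSA hS fun g g_smooth g_cpt => ?_
  have hg₁ : HasCompactSupport (Complex.ofRealCLM ∘ g) := g_cpt.comp_left rfl
  have hg₂ : ContDiff ℝ (⊤ : ℕ∞) (Complex.ofRealCLM ∘ g) := by fun_prop
  let φ : 𝓢(E, ℂ) := hg₁.toSchwartzMap hg₂
  let ψ : 𝓢(E, ℂ) := SchwartzMap.compCLMOfContinuousLinearEquiv ℂ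
    A.symm.toContinuousLinearEquiv φ
  have hψ : ∀ y, (𝓕 ψ) y = (𝓕 φ) (A.symm y) := by
    intro y
    rw [SchwartzMap.fourier_coe, SchwartzMap.fourier_coe]
    exact Real.fourier_comp_linearIsometry A.symm φ y
  have h1 : ∫ ξ, (S (A ξ) : ℂ) * φ ξ = ∫ ξ, (S ξ : ℂ) * ψ ξ := by
    rw [← A.measurePreserving.integral_comp A.toHomeomorph.measurableEmbedding
      fun ξ => (S ξ : ℂ) * ψ ξ]
    simp [ψ]
  have h2 : ∫ ξ, (S (A ξ) : ℂ) * φ ξ = ∫ ξ, (S ξ : ℂ) * φ ξ := by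
    rw [h1, ← h, ← h]
    rw [← A.symm.measurePreserving.integral_comp A.symm.toHomeomorph.measurableEmbedding
      (fun x => (k x : ℂ) * (𝓕 φ : 𝓢(E, ℂ)) x)]
    congr 1
    ext x
    rw [hψ, hk (A.symm x) x (by simp)]
  have h3 : ∀ T : E → ℝ, ((∫ ξ, g ξ • T ξ : ℝ) : ℂ) = ∫ ξ, (T ξ : ℂ) * φ ξ := by
    intro T
    rw [← integral_complex_ofReal]
    congr 1
    ext ξ
    simp [φ, mul_comm]
  have := (h3 _).trans (h2.trans (h3 _).symm)
  exact_mod_cast this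

/-- A function which is almost everywhere invariant under each linear isometry is almost
everywhere a function of the norm. -/
lemma exists_ae_eq_comp_norm [Nontrivial E] {S : E → ℝ} (hS : AEStronglyMeasurable S)
    (h : ∀ A : E ≃ₗᵢ[ℝ] E, ∀ᵐ ξ, S (A ξ) = S ξ) :
    ∃ σ : ℝ → ℝ, ∀ᵐ ξ, S ξ = σ ‖ξ‖ := by
  classical
  let U := unitary (E →L[ℝ] E)
  let _ : MeasurableSpace U := borel U
  have : BorelSpace U := ⟨rfl⟩
  have : ProperSpace (E →L[ℝ] E) := FiniteDimensional.proper ℝ _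
  have : LocallyCompactSpace U :=
    (isClosed_unitary (R := E →L[ℝ] E)).isClosedEmbedding_subtypeVal.locallyCompactSpace
  let μ : Measure U := Measure.haar
  have hT : Measurable (hS.mk S) := hS.stronglyMeasurable_mk.measurable
  have hST : S =ᵐ[volume] hS.mk S := hS.ae_eq_mk
  set T := hS.mk S
  have hTA : ∀ u : U, ∀ᵐ ξ, T ((u⁻¹ : U).1 ξ) = T ξ := by
    intro u
    have hmp := (Unitary.linearIsometryEquiv u⁻¹).measurePreserving
    filter_upwards [h (Unitary.linearIsometryEquiv u⁻¹), hST,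
      hmp.quasiMeasurePreserving.ae hST] with ξ h1 h2 h3
    rw [← h2, ← h1, h3]
    rfl
  have hmeas : MeasurableSet {p : U × E | T ((p.1⁻¹ : U).1 p.2) = T p.2} := by
    have hc : Continuous fun p : U × E => (p.1⁻¹ : U).1 p.2 :=
      (continuous_subtype_val.comp continuous_fst.inv).clm_apply continuous_snd
    exact measurableSet_eq_fun (hT.comp hc.measurable) (hT.comp measurable_snd)
  -- Fubini swaps the quantifiers: the null set for each rotation becomes one null set of points
  -- `ξ`. This needs the Borel representative `T`.
  have hae : ∀ᵐ ξ, ∀ᵐ u ∂μ, T ((u⁻¹ : U).1 ξ) = T ξ :=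
    (Measure.ae_ae_comm hmeas).1 (Filter.Eventually.of_forall hTA)
  obtain ⟨e, he⟩ := exists_norm_eq E zero_le_one
  -- `σ s` will be the value that `T` takes at Haar-almost every rotate of `s • e`.
  let P : ℝ → ℝ → Prop := fun s c => ∀ᵐ u ∂μ, T ((u⁻¹ : U).1 (s • e)) = c
  refine ⟨fun s => if hs : ∃ c, P s c then hs.choose else 0, ?_⟩
  filter_upwards [hae, hST] with ξ h1 h2
  obtain ⟨A, hA⟩ := exists_linearIsometryEquiv_apply_eq (x := ξ) (y := ‖ξ‖ • e)
    (by simp [norm_smul, he])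
  have hP : P ‖ξ‖ (T ξ) := by
    -- Left invariance of Haar measure moves the base point from `ξ` to `‖ξ‖ • e`.
    filter_upwards [(measurePreserving_mul_left μ
      (Unitary.linearIsometryEquiv.symm A)⁻¹).quasiMeasurePreserving.ae h1] with u hu
    rw [← hu, ← hA, mul_inv_rev, inv_inv]
    rfl
  have hex : ∃ c, P ‖ξ‖ c := ⟨_, hP⟩
  rw [dif_pos hex, h2]
  obtain ⟨u, hu1, hu2⟩ := (hP.and hex.choose_spec).exists
  exact hu1.symm.trans hu2

end Radial

/-! ### The Hankel transform -/

lemma integral_sphere_cos_inner_smul {d : ℕ} (hd : 1 ≤ d) {x : EuclideanSpace ℝ (Fin d)}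
    (hx : x ≠ 0) {s : ℝ} (hs : 0 < s) :
    s ^ (d - 1) * ∫ ω : Metric.sphere (0 : EuclideanSpace ℝ (Fin d)) 1,
      Real.cos (2 * Real.pi * inner ℝ x (s • (ω : EuclideanSpace ℝ (Fin d))))
      ∂(volume : Measure (EuclideanSpace ℝ (Fin d))).toSphere =
    2 * Real.pi / ‖x‖ ^ ((d : ℝ) / 2 - 1) *
      (besselJ ((d : ℝ) / 2 - 1) (2 * Real.pi * ‖x‖ * s) * s ^ ((d : ℝ) / 2)) := by
  have hx0 : 0 < ‖x‖ := norm_pos_iff.2 hx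
  have hpi := Real.pi_pos
  have hne : (2 * Real.pi * s) • x ≠ 0 := smul_ne_zero (by positivity) hx
  have h := integral_sphere_cos_inner hd hne
  have hn : ‖(2 * Real.pi * s) • x‖ = 2 * Real.pi * ‖x‖ * s := by
    rw [norm_smul, Real.norm_of_nonneg (by positivity)]
    ring
  have hc : ∀ ω : Metric.sphere (0 : EuclideanSpace ℝ (Fin d)) 1,
      Real.cos (2 * Real.pi * inner ℝ x (s • (ω : EuclideanSpace ℝ (Fin d)))) =
      Real.cos (inner ℝ ((2 * Real.pi * s) • x) (ω : EuclideanSpace ℝ (Fin d))) := by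
    intro ω
    rw [inner_smul_left, inner_smul_right]
    simp [mul_assoc]
  simp only [hc]
  rw [h, hn, show 2 * Real.pi * ‖x‖ * s / 2 = Real.pi * (‖x‖ * s) by ring,
    Real.mul_rpow hpi.le (by positivity), Real.mul_rpow hx0.le hs.le,
    Real.rpow_sub hpi, Real.rpow_sub hx0, Real.rpow_sub hs, Real.rpow_sub hx0]
  have h1 : s ^ (d - 1) * s = (s ^ ((d : ℝ) / 2)) ^ 2 := by
    rw [← pow_succ, Nat.sub_add_cancel hd, ← Real.rpow_natCast, ← Real.rpow_natCast,
      ← Real.rpow_mul hs.le]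
    congr 1
    push_cast
    ring
  have := Real.rpow_pos_of_pos hpi ((d : ℝ) / 2)
  have := Real.rpow_pos_of_pos hs ((d : ℝ) / 2)
  have := Real.rpow_pos_of_pos hx0 ((d : ℝ) / 2)
  simp only [Real.rpow_one]
  generalize besselJ ((d : ℝ) / 2 - 1) (2 * Real.pi * ‖x‖ * s) = J
  field_simp
  linear_combination J * h1

/-- Integration of a radial function against a plane wave as a Hankel transform. -/
lemma integrableOn_and_integral_mul_cos_eq_besselJ {d : ℕ} (hd : 1 ≤ d) {S : EuclideanSpace ℝ (Fin d) → ℝ}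
    (hS : MemLp S 2) {σ : ℝ → ℝ} (hσ : ∀ᵐ ξ, S ξ = σ ‖ξ‖) {x : EuclideanSpace ℝ (Fin d)}
    (hx : x ≠ 0) :
    IntegrableOn (fun s : ℝ => σ s ^ 2 * besselJ ((d : ℝ) / 2 - 1) (2 * Real.pi * ‖x‖ * s)
          * s ^ ((d : ℝ) / 2)) (Set.Ioi 0) ∧
    ∫ ξ, S ξ ^ 2 * Real.cos (2 * Real.pi * inner ℝ x ξ) =
      2 * Real.pi / ‖x‖ ^ ((d : ℝ) / 2 - 1) *
        ∫ s in Set.Ioi (0 : ℝ), σ s ^ 2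
          * besselJ ((d : ℝ) / 2 - 1) (2 * Real.pi * ‖x‖ * s) * s ^ ((d : ℝ) / 2) := by
  have : Nontrivial (EuclideanSpace ℝ (Fin d)) := ⟨x, 0, hx⟩
  have hx0 : 0 < ‖x‖ := norm_pos_iff.2 hx
  set c := 2 * Real.pi / ‖x‖ ^ ((d : ℝ) / 2 - 1) with hc
  have hc0 : c ≠ 0 := by positivity
  have hσi : Integrable fun ξ : EuclideanSpace ℝ (Fin d) => σ ‖ξ‖ ^ 2 := by
    refine hS.integrable_sq.congr ?_
    filter_upwards [hσ] with ξ h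
    rw [h]
  -- Radial integrability comes from that of `S ^ 2`; no measurability of `σ` is assumed.
  have hσr := (integrable_fun_norm_addHaar (volume : Measure (EuclideanSpace ℝ (Fin d)))
    (f := fun s => σ s ^ 2)).1 hσi
  simp only [finrank_euclideanSpace, Fintype.card_fin, smul_eq_mul] at hσr
  let B : ℝ → ℝ := fun s => ∫ ω : Metric.sphere (0 : EuclideanSpace ℝ (Fin d)) 1,
      Real.cos (2 * Real.pi * inner ℝ x (s • (ω : EuclideanSpace ℝ (Fin d))))
      ∂(volume : Measure (EuclideanSpace ℝ (Fin d))).toSphere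
  have hB : ∀ s ∈ Set.Ioi (0 : ℝ), s ^ (d - 1) * σ s ^ 2 * B s = c * (σ s ^ 2
      * besselJ ((d : ℝ) / 2 - 1) (2 * Real.pi * ‖x‖ * s) * s ^ ((d : ℝ) / 2)) := by
    intro s hs
    have := integral_sphere_cos_inner_smul hd hx hs
    linear_combination σ s ^ 2 * this
  have hBm : StronglyMeasurable B := by
    refine StronglyMeasurable.integral_prod_right (f := fun (s : ℝ)
      (ω : Metric.sphere (0 : EuclideanSpace ℝ (Fin d)) 1) =>
      Real.cos (2 * Real.pi * inner ℝ x (s • (ω : EuclideanSpace ℝ (Fin d))))) ?_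
    refine Continuous.stronglyMeasurable ?_
    unfold Function.uncurry
    fun_prop
  have hBb : ∀ s, ‖B s‖ ≤ (volume : Measure (EuclideanSpace ℝ (Fin d))).toSphere.real Set.univ := by
    intro s
    refine (norm_integral_le_of_norm_le_const (C := 1) (Filter.Eventually.of_forall fun ω => ?_)).trans ?_
    · exact Real.abs_cos_le_one _
    · rw [one_mul]
  have hint : IntegrableOn (fun s => s ^ (d - 1) * σ s ^ 2 * B s) (Set.Ioi 0) :=
    hσr.mul_bdd hBm.aestronglyMeasurable (Filter.Eventually.of_forall hBb)
  constructor
  · have := (hint.congr_fun hB measurableSet_Ioi).const_mul c⁻¹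
    simp only [inv_mul_cancel_left₀ hc0] at this
    exact this
  · rw [← integral_const_mul, ← setIntegral_congr_fun measurableSet_Ioi hB]
    have hcos : Continuous fun ξ : EuclideanSpace ℝ (Fin d) =>
      Real.cos (2 * Real.pi * inner ℝ x ξ) := by fun_prop
    have hi : Integrable fun ξ : EuclideanSpace ℝ (Fin d) =>
        σ ‖ξ‖ ^ 2 * Real.cos (2 * Real.pi * inner ℝ x ξ) :=
      hσi.mul_bdd (c := 1) hcos.aestronglyMeasurable
        (Filter.Eventually.of_forall fun ξ => Real.abs_cos_le_one _)
    have h1 : ∫ ξ, S ξ ^ 2 * Real.cos (2 * Real.pi * inner ℝ x ξ) =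
        ∫ ξ : EuclideanSpace ℝ (Fin d), σ ‖ξ‖ ^ 2 * Real.cos (2 * Real.pi * inner ℝ x ξ) := by
      refine integral_congr_ae ?_
      filter_upwards [hσ] with ξ h
      rw [h]
    rw [h1, integral_eq_integral_Ioi_integral_sphere volume hi]
    refine setIntegral_congr_fun measurableSet_Ioi fun s hs => ?_
    have hn : ∀ ω : Metric.sphere (0 : EuclideanSpace ℝ (Fin d)) 1,
        ‖s • (ω : EuclideanSpace ℝ (Fin d))‖ = s := fun ω => by
      rw [norm_smul, Real.norm_of_nonneg hs.out.le]
      simp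
    simp only [hn, integral_const_mul, finrank_euclideanSpace, Fintype.card_fin, B, mul_assoc]

/-! ### The main theorem -/

theorem mainTheorem6 (d : ℕ) (hd : 1 ≤ d) (k S : EuclideanSpace ℝ (Fin d) → ℝ)
    (hk : IsStationaryIsotropicCovariance k)
    (hk2 : MeasureTheory.MemLp k 2 MeasureTheory.volume)
    (hS : IsSpectralDensity k S) :
    -- the self-convolution is defined everywhere by an absolutely convergent integral
    MeasureTheory.ConvolutionExists k k (ContinuousLinearMap.mul ℝ ℝ) MeasureTheory.volume ∧
    -- the spectral density is a function `σ` of the norm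
    (∃ σ : ℝ → ℝ, ∀ᵐ ξ : EuclideanSpace ℝ (Fin d), S ξ = σ ‖ξ‖) ∧
    ∀ σ : ℝ → ℝ, (∀ᵐ ξ : EuclideanSpace ℝ (Fin d), S ξ = σ ‖ξ‖) →
      (∀ r : ℝ, 0 < r → MeasureTheory.IntegrableOn
        (fun s : ℝ => σ s ^ 2 * besselJ ((d : ℝ) / 2 - 1) (2 * Real.pi * r * s)
          * s ^ ((d : ℝ) / 2)) (Set.Ioi 0)) ∧
      (∀ x : EuclideanSpace ℝ (Fin d), x ≠ 0 →
        (k ⋆[ContinuousLinearMap.mul ℝ ℝ, MeasureTheory.volume] k) x =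
          2 * Real.pi / ‖x‖ ^ ((d : ℝ) / 2 - 1) *
            ∫ s in Set.Ioi (0 : ℝ), σ s ^ 2
              * besselJ ((d : ℝ) / 2 - 1) (2 * Real.pi * ‖x‖ * s) * s ^ ((d : ℝ) / 2)) ∧
      -- at the origin the right-hand side is read as its limit
      Filter.Tendsto
        (fun r : ℝ => 2 * Real.pi / r ^ ((d : ℝ) / 2 - 1) *
          ∫ s in Set.Ioi (0 : ℝ), σ s ^ 2
            * besselJ ((d : ℝ) / 2 - 1) (2 * Real.pi * r * s) * s ^ ((d : ℝ) / 2))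
        (𝓝[>] 0)
        (𝓝 ((k ⋆[ContinuousLinearMap.mul ℝ ℝ, MeasureTheory.volume] k) 0)) := by
  obtain ⟨n, rfl⟩ : ∃ n, d = n + 1 := ⟨d - 1, by omega⟩
  obtain ⟨hS2, hconv⟩ := integral_mul_sub_eq_integral_sq_mul_cos hk2 hS.locallyIntegrable
    hS.integral_fourier
  have hconv' : ∀ x, (k ⋆[ContinuousLinearMap.mul ℝ ℝ, MeasureTheory.volume] k) x =
      ∫ ξ, S ξ ^ 2 * Real.cos (2 * Real.pi * inner ℝ x ξ) := by
    intro x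
    rw [← hconv x, convolution_def]
    congr 1
    ext y
    rw [ContinuousLinearMap.mul_apply', hk.isotropic (x - y) (y - x) (norm_sub_rev x y)]
  have hdir : ∀ r : ℝ, 0 < r →
      r • EuclideanSpace.single (0 : Fin (n + 1)) (1 : ℝ) ≠ 0 ∧
      ‖r • EuclideanSpace.single (0 : Fin (n + 1)) (1 : ℝ)‖ = r := by
    intro r hr
    have h : ‖r • EuclideanSpace.single (0 : Fin (n + 1)) (1 : ℝ)‖ = r := by
      simp [norm_smul, abs_of_pos hr]
    exact ⟨norm_pos_iff.1 (by rwa [h]), h⟩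
  refine ⟨fun x => ?_, exists_ae_eq_comp_norm hS.locallyIntegrable.aestronglyMeasurable
    (fourier_comp_linearIsometryEquiv_ae_eq hk.isotropic hS.locallyIntegrable
      hS.integral_fourier), fun σ hσ => ⟨fun r hr => ?_, fun x hx => ?_, ?_⟩⟩
  · exact hk2.integrable_mul
      (hk2.comp_measurePreserving (Measure.measurePreserving_sub_left volume x))
  · obtain ⟨h0, h1⟩ := hdir r hr
    simpa only [h1] using (integrableOn_and_integral_mul_cos_eq_besselJ hd hS2 hσ h0).1
  · rw [hconv' x, (integrableOn_and_integral_mul_cos_eq_besselJ hd hS2 hσ hx).2]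
  · have hcont : Continuous fun r : ℝ =>
        ∫ ξ, S ξ ^ 2 * Real.cos
          (2 * Real.pi * inner ℝ (r • EuclideanSpace.single (0 : Fin (n + 1)) (1 : ℝ)) ξ) := by
      refine continuous_of_dominated (bound := fun ξ => S ξ ^ 2) (fun r => ?_) (fun r => ?_)
        hS2.integrable_sq (Filter.Eventually.of_forall fun ξ => by fun_prop)
      · exact hS2.integrable_sq.aestronglyMeasurable.mul
          (Continuous.aestronglyMeasurable (by fun_prop))
      · refine Filter.Eventually.of_forall fun ξ => ?_
        rw [norm_mul, Real.norm_of_nonneg (sq_nonneg _)]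
        exact mul_le_of_le_one_right (sq_nonneg _) (Real.abs_cos_le_one _)
    have h0 := (hcont.tendsto 0).mono_left (nhdsWithin_le_nhds (s := Set.Ioi 0))
    rw [hconv' 0]
    rw [zero_smul] at h0
    refine h0.congr' ?_
    filter_upwards [self_mem_nhdsWithin] with r hr
    obtain ⟨h2, h1⟩ := hdir r hr
    rw [(integrableOn_and_integral_mul_cos_eq_besselJ hd hS2 hσ h2).2, h1]
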